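/- Let $\Gamma$ be a set of lattice sites and $n\in\mathbb N$. For $l\in\Gamma$ let $m_l,\nu_l>0$, and for $k,l\in\Gamma$ let $V_{kl}\in C^1_0(\mathbb R^n,\mathbb R)$ (continuously differentiable and vanishing at infinity) be such that $\nabla V_{kl}$ is Lipschitz continuous and $V_{kl}(x)=V_{lk}(-x)$ for all $x$. For a finite set $\Lambda\subseteq\Gamma$ let $\Omega_\Lambda=\{(p,q): p=(p_l)_{l\in\Lambda},\ q=(q_l)_{l\in\Lambda},\ p_l,q_l\in\mathbb R^n\}\cong\mathbb R^{2n|\Lambda|}$ with the Euclidean inner product, and let $H_\Lambda=H^0_\Lambda+V_\Lambda$, where $$H^0_\Lambda(p,q)=\sum_{l\in\Lambda}\Big(\frac{\|p_l\|^2}{2m_l}+\frac{\nu_l\|q_l\|^2}{2}\Big),\qquad V_\Lambda(p,q)=\sum_{k,l\in\Lambda}V_{kl}(q_k-q_l).$$ For a real inner product space $X$, let $C_{\mathcal R}(X)$ be the C*-subalgebra of $C_b(X)$ generated by the functions $y\mapsto 1/(i\lambda-x\cdot y)$ with $x\in X$ and $\lambda\in\mathbb R\setminus\{0\}$. Then Hamilton's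 equations $(\dot p,\dot q)=(-\nabla_qH_\Lambda(p,q),\nabla_pH_\Lambda(p,q))$ have, for every initial value in $\Omega_\Lambda$, a unique solution defined on all of $\mathbb R$; the time-$t$ maps $\Phi^t_{H_\Lambda}:\Omega_\Lambda\to\Omega_\Lambda$ of the resulting flow are homeomorphisms; and the flow preserves the commutative resolvent algebra: $$(\Phi^t_{H_\Lambda})^*\,C_{\mathcal R}(\Omega_\Lambda)=\{f\circ\Phi^t_{H_\Lambda}: f\in C_{\mathcal R}(\Omega_\Lambda)\}=C_{\mathcal R}(\Omega_\Lambda)\qquad\text{for all }t\in\mathbb R.$$ -/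

import Mathlib

open scoped BoundedContinuousFunction

noncomputable section

/-- The classical resolvent `y ↦ 1 / (i λ - x · y)` (with `λ ≠ 0`), as a bounded continuous
function on a real inner product space. -/
def classicalResolvent {X : Type*} [NormedAddCommGroup X] [InnerProductSpace ℝ X]
    (x : X) (a : ℝ) (ha : a ≠ 0) : X →ᵇ ℂ :=
  BoundedContinuousFunction.ofNormedAddCommGroup
    (fun y => 1 / (Complex.I * (a : ℂ) - ((inner ℝ x y : ℝ) : ℂ)))
    (by
      refine Continuous.div continuous_const (by fun_prop) fun y h => ha ?_
      simpa using congrArg Complex.im h)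
    (1 / |a|)
    (by
      intro y
      rw [norm_div, norm_one]
      refine one_div_le_one_div_of_le (abs_pos.mpr ha) ?_
      simpa using
        Complex.abs_im_le_norm (Complex.I * (a : ℂ) - ((inner ℝ x y : ℝ) : ℂ)))

/-- The commutative resolvent algebra `C_R(X)`: the C*-subalgebra of `C_b(X)` generated by the
classical resolvents. (It contains the constants, since the resolvent at `x = 0` is a non-zero
constant.) -/
def resolventAlgebra (X : Type*) [NormedAddCommGroup X] [InnerProductSpace ℝ X] :
    StarSubalgebra ℂ (X →ᵇ ℂ) :=
  (StarAlgebra.adjoin ℂ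
    {f : X →ᵇ ℂ | ∃ (x : X) (a : ℝ) (ha : a ≠ 0), f = classicalResolvent x a ha}).topologicalClosure

/-- The phase space `Ω_Λ ≅ ℝ^{2n|Λ|}` of pairs `(p, q)`, `p = (p_{l,i})`, `q = (q_{l,i})`, with
`l ∈ Λ` and `1 ≤ i ≤ n`, with the Euclidean inner product. The index `Sum.inl (l, i)` stands for the
momentum coordinate `p_{l,i}`, and `Sum.inr (l, i)` for the position coordinate `q_{l,i}`. -/
abbrev PhaseSpace {Γ : Type*} (Λ : Finset Γ) (n : ℕ) : Type _ :=
  EuclideanSpace ℝ ((Λ × Fin n) ⊕ (Λ × Fin n))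

/-- The momentum `p_l ∈ ℝⁿ` of the particle `l`. -/
def momentum {Γ : Type*} {Λ : Finset Γ} {n : ℕ} (w : PhaseSpace Λ n) (l : Λ) :
    EuclideanSpace ℝ (Fin n) :=
  WithLp.toLp 2 fun i => w (Sum.inl (l, i))

/-- The position `q_l ∈ ℝⁿ` of the particle `l`. -/
def position {Γ : Type*} {Λ : Finset Γ} {n : ℕ} (w : PhaseSpace Λ n) (l : Λ) :
    EuclideanSpace ℝ (Fin n) :=
  WithLp.toLp 2 fun i => w (Sum.inr (l, i))

/-- The free Hamiltonian `H⁰_Λ(p, q) = ∑_{l ∈ Λ} (‖p_l‖² / (2 m_l) + ν_l ‖q_l‖² / 2)`. -/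
def freeHamiltonian {Γ : Type*} (Λ : Finset Γ) (n : ℕ) (m ν : Γ → ℝ) (w : PhaseSpace Λ n) : ℝ :=
  ∑ l : Λ, (‖momentum w l‖ ^ 2 / (2 * m l) + ν l * ‖position w l‖ ^ 2 / 2)

/-- The potential `V_Λ(p, q) = ∑_{k, l ∈ Λ} V_{kl}(q_k - q_l)` (sum over ordered pairs). -/
def interaction {Γ : Type*} (Λ : Finset Γ) (n : ℕ)
    (V : Γ → Γ → EuclideanSpace ℝ (Fin n) → ℝ) (w : PhaseSpace Λ n) : ℝ :=
  ∑ k : Λ, ∑ l : Λ, V k l (position w k - position w l)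

/-- The local Hamiltonian `H_Λ = H⁰_Λ + V_Λ`. -/
def localHamiltonian {Γ : Type*} (Λ : Finset Γ) (n : ℕ) (m ν : Γ → ℝ)
    (V : Γ → Γ → EuclideanSpace ℝ (Fin n) → ℝ) (w : PhaseSpace Λ n) : ℝ :=
  freeHamiltonian Λ n m ν w + interaction Λ n V w

/-- The Hamiltonian vector field `X_H(p, q) = (-∇_q H(p, q), ∇_p H(p, q))`. -/
def hamiltonianVectorField {Γ : Type*} {Λ : Finset Γ} {n : ℕ} (H : PhaseSpace Λ n → ℝ)
    (w : PhaseSpace Λ n) : PhaseSpace Λ n :=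
  WithLp.toLp 2 (Sum.elim
    (fun a => -(gradient H w) (Sum.inr a))
    (fun a => (gradient H w) (Sum.inl a)))

/-- `γ : ℝ → Ω_Λ` solves Hamilton's equations for `H` at all times. -/
def IsHamiltonSolution {Γ : Type*} {Λ : Finset Γ} {n : ℕ} (H : PhaseSpace Λ n → ℝ)
    (γ : ℝ → PhaseSpace Λ n) : Prop :=
  ∀ t : ℝ, HasDerivAt γ (hamiltonianVectorField H (γ t)) t

/-- `Φ` is the Hamiltonian flow of `H`: for every `w`, the curve `t ↦ Φ t w` is the unique global
solution of Hamilton's equations starting at `w`. -/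
structure IsHamiltonianFlow {Γ : Type*} {Λ : Finset Γ} {n : ℕ} (H : PhaseSpace Λ n → ℝ)
    (Φ : ℝ → PhaseSpace Λ n → PhaseSpace Λ n) : Prop where
  initial : ∀ w, Φ 0 w = w
  solution : ∀ w, IsHamiltonSolution H (fun t => Φ t w)
  unique : ∀ γ : ℝ → PhaseSpace Λ n, IsHamiltonSolution H γ → ∀ t, γ t = Φ t (γ 0)

end

noncomputable section

open scoped BoundedContinuousFunction Topology NNReal
open Filter

/-! Hamilton's equations have the form `w' = A w + F w`, with `A` linear (the harmonic part) and `F`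
a finite sum of fields `G ∘ L`, where `L` is a relative position and `G` is Lipschitz and vanishes
at infinity. As `F` is bounded and Lipschitz, the flow is global. It is the limit, uniformly on
phase space, of iterates of the step `w ↦ e^{τA}(w + ∫₀^τ e^{-sA} F(e^{sA} w) ds)`, whose local
error is `O(τ²)`. The algebra is closed and its elements are uniformly continuous, so it is enough
that one step preserves it (`compContinuous_flow_mem`).

Linear maps send resolvents to resolvents. A map `id + k` preserves the algebra when the components
of `k` lie in it, because C*-subalgebras are closed under inversion (`compContinuous_id_add_mem`).

The crux is that the time average has components in the algebra
(`exists_mem_resolventAlgebra_average`). For fixed `s` the integrand is a `C₀` function of a linear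
image of `w`, but it need not be norm continuous in `s`, since the kernel of `L e^{sA}` moves. Its
integral is nevertheless `C₀` on the orthogonal complement of the common kernel: there `s ↦ L e^{sA}
d` is analytic and not identically zero for `d ≠ 0`, so it vanishes only on a null set, and
dominated convergence applies. Stone–Weierstrass puts such functions in the algebra. Time reversal
turns inclusion into equality. -/

/-- Precomposition with a continuous map, as a star algebra homomorphism. -/
def compContinuousStarAlgHom {X Y : Type*} [TopologicalSpace X] [TopologicalSpace Y]
    (g : C(X, Y)) : (Y →ᵇ ℂ) →⋆ₐ[ℂ] (X →ᵇ ℂ) where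
  toFun f := f.compContinuous g
  map_one' := rfl
  map_mul' _ _ := rfl
  map_zero' := rfl
  map_add' _ _ := rfl
  commutes' _ := rfl
  map_star' _ := rfl

/-! ### Stability properties of the resolvent algebra. -/

section

variable {X Y : Type*} [NormedAddCommGroup X] [InnerProductSpace ℝ X]
  [NormedAddCommGroup Y] [InnerProductSpace ℝ Y]

theorem isClosed_resolventAlgebra :
    IsClosed (resolventAlgebra X : Set (X →ᵇ ℂ)) :=
  StarSubalgebra.isClosed_topologicalClosure _

theorem classicalResolvent_mem (x : X) (a : ℝ) (ha : a ≠ 0) :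
    classicalResolvent x a ha ∈ resolventAlgebra X :=
  StarSubalgebra.le_topologicalClosure _ (StarAlgebra.subset_adjoin ℂ _ ⟨x, a, ha, rfl⟩)

theorem classicalResolvent_apply (x : X) (a : ℝ) (ha : a ≠ 0) (y : X) :
    classicalResolvent x a ha y = 1 / (Complex.I * (a : ℂ) - ((inner ℝ x y : ℝ) : ℂ)) := rfl

/-- To show that a closed star subalgebra contains the resolvent algebra it suffices to treat the
generators. -/
theorem resolventAlgebra_le {S : StarSubalgebra ℂ (X →ᵇ ℂ)} (hS : IsClosed (S : Set (X →ᵇ ℂ)))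
    (h : ∀ (x : X) (a : ℝ) (ha : a ≠ 0), classicalResolvent x a ha ∈ S) :
    resolventAlgebra X ≤ S := by
  refine StarSubalgebra.topologicalClosure_minimal ?_ hS
  refine StarAlgebra.adjoin_le ?_
  rintro _ ⟨x, a, ha, rfl⟩
  exact h x a ha

theorem compContinuous_mem_resolventAlgebra (g : C(X, Y))
    (h : ∀ (y : Y) (a : ℝ) (ha : a ≠ 0),
      (classicalResolvent y a ha).compContinuous g ∈ resolventAlgebra X)
    {f : Y →ᵇ ℂ} (hf : f ∈ resolventAlgebra Y) :
    f.compContinuous g ∈ resolventAlgebra X := by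
  have hle : resolventAlgebra Y ≤ (resolventAlgebra X).comap (compContinuousStarAlgHom g) :=
    resolventAlgebra_le (isClosed_resolventAlgebra.preimage
      (BoundedContinuousFunction.continuous_compContinuous g)) h
  exact hle hf

/-- Since `x · P w = P* x · w`, generators are pulled back to generators. -/
theorem compContinuous_clm_mem [CompleteSpace X] [CompleteSpace Y] (P : X →L[ℝ] Y) {f : Y →ᵇ ℂ}
    (hf : f ∈ resolventAlgebra Y) :
    f.compContinuous (P : C(X, Y)) ∈ resolventAlgebra X := by
  refine compContinuous_mem_resolventAlgebra _ (fun y a ha => ?_) hf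
  convert classicalResolvent_mem (ContinuousLinearMap.adjoint P y) a ha using 1
  ext w
  simp [classicalResolvent_apply, ContinuousLinearMap.adjoint_inner_left]

/-- Elements of the resolvent algebra are uniformly continuous. -/
theorem uniformContinuous_of_mem_resolventAlgebra {f : X →ᵇ ℂ} (hf : f ∈ resolventAlgebra X) :
    UniformContinuous f := by
  let S : StarSubalgebra ℂ (X →ᵇ ℂ) :=
    { carrier := {f | UniformContinuous f}
      mul_mem' := by
        intro f g hf hg
        rw [Set.mem_ofPred_eq, Metric.uniformContinuous_iff] at *
        intro ε hε
        obtain ⟨δ₁, h₁, H₁⟩ := hf (ε / (2 * (‖g‖ + 1))) (by positivity)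
        obtain ⟨δ₂, h₂, H₂⟩ := hg (ε / (2 * (‖f‖ + 1))) (by positivity)
        refine ⟨min δ₁ δ₂, lt_min h₁ h₂, fun x y hxy => ?_⟩
        have e₁ := H₁ (hxy.trans_le (min_le_left _ _))
        have e₂ := H₂ (hxy.trans_le (min_le_right _ _))
        rw [dist_eq_norm] at *
        have : (f * g) x - (f * g) y = (f x - f y) * g x + f y * (g x - g y) := by
          simp only [BoundedContinuousFunction.mul_apply]; ring
        rw [this]
        refine (norm_add_le _ _).trans_lt ?_
        rw [norm_mul, norm_mul]
        have a₁ := g.norm_coe_le_norm x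
        have a₂ := f.norm_coe_le_norm y
        have p₁ : ‖f x - f y‖ * ‖g x‖ ≤ ‖f x - f y‖ * (‖g‖ + 1) := by gcongr; linarith
        have p₂ : ‖f y‖ * ‖g x - g y‖ ≤ (‖f‖ + 1) * ‖g x - g y‖ := by gcongr; linarith
        have n₁ := norm_nonneg g
        have n₂ := norm_nonneg f
        rw [lt_div_iff₀ (by positivity)] at e₁ e₂
        linarith
      add_mem' := fun hf hg => UniformContinuous.add hf hg
      algebraMap_mem' := fun r => uniformContinuous_const
      star_mem' := fun hf => Complex.conjLIE.isometry.uniformContinuous.comp hf }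
  have hS : IsClosed (S : Set (X →ᵇ ℂ)) := by
    have : IsClosed {f : X →ᵇ ℂ | UniformContinuous f} := by
      refine isClosed_of_closure_subset fun f hf => ?_
      rw [Set.mem_ofPred_eq, Metric.uniformContinuous_iff]
      intro ε hε
      obtain ⟨g, hg, hfg⟩ := Metric.mem_closure_iff.1 hf (ε / 3) (by positivity)
      obtain ⟨δ, hδ, H⟩ := Metric.uniformContinuous_iff.1 hg (ε / 3) (by positivity)
      refine ⟨δ, hδ, fun x y hxy => ?_⟩
      have h1 := (BoundedContinuousFunction.dist_coe_le_dist (f := f) (g := g) x)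
      have h2 := (BoundedContinuousFunction.dist_coe_le_dist (f := f) (g := g) y)
      have h3 := dist_triangle4 (f x) (g x) (g y) (f y)
      rw [dist_comm (g y)] at h3
      linarith [H hxy]
    exact this
  refine resolventAlgebra_le hS (fun x a ha => ?_) hf
  change UniformContinuous (classicalResolvent x a ha)
  -- Resolvent identity: the difference is the product of both resolvents times `s - t`, and each is
  -- bounded by `1 / |a|`.
  have key : ∀ s t : ℝ, ‖1 / (Complex.I * (a : ℂ) - (s : ℂ)) - 1 / (Complex.I * (a : ℂ) - (t : ℂ))‖
      ≤ (1 / |a| * (1 / |a|)) * ‖s - t‖ := by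
    intro s t
    have hb : ∀ s : ℝ, |a| ≤ ‖Complex.I * (a : ℂ) - (s : ℂ)‖ := fun s => by
      simpa using Complex.abs_im_le_norm (Complex.I * (a : ℂ) - (s : ℂ))
    have ha' : 0 < |a| := abs_pos.2 ha
    have hs : Complex.I * (a : ℂ) - (s : ℂ) ≠ 0 := norm_pos_iff.1 (ha'.trans_le (hb s))
    have ht : Complex.I * (a : ℂ) - (t : ℂ) ≠ 0 := norm_pos_iff.1 (ha'.trans_le (hb t))
    have : 1 / (Complex.I * (a : ℂ) - (s : ℂ)) - 1 / (Complex.I * (a : ℂ) - (t : ℂ))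
        = (1 / (Complex.I * (a : ℂ) - (s : ℂ)) * (1 / (Complex.I * (a : ℂ) - (t : ℂ)))) *
          ((s - t : ℝ) : ℂ) := by
      push_cast
      field_simp
      ring
    rw [this, norm_mul, norm_mul, norm_div, norm_div, norm_one, Complex.norm_real]
    gcongr
    · exact hb s
    · exact hb t
  have hu : UniformContinuous (fun s : ℝ => 1 / (Complex.I * (a : ℂ) - (s : ℂ))) := by
    refine (LipschitzWith.of_dist_le_mul (K := ⟨1 / |a| * (1 / |a|), by positivity⟩)
      fun s t => ?_).uniformContinuous
    rw [dist_eq_norm, dist_eq_norm]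
    exact key s t
  exact hu.comp (innerSL ℝ x).uniformContinuous

/-- The resolvent algebra is stable under `f ↦ f ∘ (id + k)` if `k` has components in the
resolvent algebra. -/
theorem compContinuous_id_add_mem (k : X → X) (hk : Continuous k)
    (hmem : ∀ x : X, ∃ κ ∈ resolventAlgebra X, ∀ w, κ w = ((inner ℝ x (k w) : ℝ) : ℂ))
    {f : X →ᵇ ℂ} (hf : f ∈ resolventAlgebra X) :
    f.compContinuous ⟨fun w => w + k w, by fun_prop⟩ ∈ resolventAlgebra X := by
  refine compContinuous_mem_resolventAlgebra _ (fun x a ha => ?_) hf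
  obtain ⟨κ, hκ, hκw⟩ := hmem x
  set r := classicalResolvent x a ha with hr
  have hrm : r ∈ resolventAlgebra X := classicalResolvent_mem x a ha
  have ha' : 0 < |a| := abs_pos.2 ha
  have hb : ∀ s : ℝ, |a| ≤ ‖Complex.I * (a : ℂ) - (s : ℂ)‖ := fun s => by
    simpa using Complex.abs_im_le_norm (Complex.I * (a : ℂ) - (s : ℂ))
  have hne : ∀ s : ℝ, Complex.I * (a : ℂ) - (s : ℂ) ≠ 0 :=
    fun s => norm_pos_iff.1 (ha'.trans_le (hb s))
  let r' := (classicalResolvent x a ha).compContinuous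
    (⟨fun w => w + k w, by fun_prop⟩ : C(X, X))
  have hr' : ∀ w, r' w = 1 / (Complex.I * (a : ℂ) - ((inner ℝ x w + inner ℝ x (k w) : ℝ) : ℂ)) := by
    intro w
    simp [r', classicalResolvent_apply, inner_add_right]
  have hone : ∀ w, (1 : X →ᵇ ℂ) w = 1 := fun _ => rfl
  -- With `z = i a - x · w`, the factors are `(z - κ) / z` and `z / (z - κ)`.
  have hinv : (1 - κ * r) * (1 + κ * r') = 1 := by
    ext w
    have h1 := hne (inner ℝ x w)
    have h2 := hne (inner ℝ x w + inner ℝ x (k w))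
    simp only [BoundedContinuousFunction.mul_apply, BoundedContinuousFunction.sub_apply,
      BoundedContinuousFunction.add_apply, hone, hr, hr', hκw,
      classicalResolvent_apply]
    push_cast at h1 h2 ⊢
    field_simp
    ring
  have hm : 1 - κ * r ∈ resolventAlgebra X := sub_mem (one_mem _) (mul_mem hκ hrm)
  have : IsClosed (resolventAlgebra X : Set (X →ᵇ ℂ)) := isClosed_resolventAlgebra
  have hu : IsUnit ((⟨1 - κ * r, hm⟩ : resolventAlgebra X) : X →ᵇ ℂ) :=
    IsUnit.of_mul_eq_one _ hinv
  -- Spectral permanence: an inverse in the bounded continuous functions already lies in the closed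
  -- star subalgebra.
  obtain ⟨c, hc⟩ := ((resolventAlgebra X).coe_isUnit.1 hu).exists_right_inv
  have hc' : (1 - κ * r) * (c : X →ᵇ ℂ) = 1 := congrArg Subtype.val hc
  have hceq : (c : X →ᵇ ℂ) = 1 + κ * r' := by
    calc (c : X →ᵇ ℂ) = ((1 - κ * r) * (1 + κ * r')) * c := by rw [hinv, one_mul]
      _ = ((1 - κ * r) * c) * (1 + κ * r') := by ring
      _ = 1 + κ * r' := by rw [hc', one_mul]
  have : r' = r * c := by
    rw [hceq]
    ext w
    have h1 := hne (inner ℝ x w)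
    have h2 := hne (inner ℝ x w + inner ℝ x (k w))
    simp only [BoundedContinuousFunction.mul_apply,
      BoundedContinuousFunction.add_apply, hone, hr, hr', hκw,
      classicalResolvent_apply]
    push_cast at h1 h2 ⊢
    field_simp
    ring
  change r' ∈ _
  rw [this]
  exact mul_mem hrm c.2

end

/-! ### `C₀` functions of linear images, by Stone–Weierstrass. -/

section

variable {X E : Type*} [NormedAddCommGroup X] [InnerProductSpace ℝ X] [CompleteSpace X]
  [NormedAddCommGroup E] [InnerProductSpace ℝ E] [FiniteDimensional ℝ E]

/-- A single resolvent does not vanish at infinity in general, but the product over a basis does: `∏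
(1 + sᵢ²) ≥ 1 + ∑ sᵢ² ≥ ‖y‖²` bounds it by `1 / ‖y‖`. -/
theorem tendsto_prod_resolvent_cocompact (ι : Type*) [Fintype ι] (b : OrthonormalBasis ι ℝ E) :
    Tendsto (fun y : E => ∏ i, 1 / (Complex.I - ((inner ℝ (b i) y : ℝ) : ℂ))) (cocompact E)
      (𝓝 0) := by
  have hb : ∀ s : ℝ, ‖Complex.I - (s : ℂ)‖ ^ 2 = 1 + s ^ 2 := fun s => by
    rw [Complex.sq_norm, Complex.normSq_apply]; simp; ring
  have hle : ∀ y : E, ‖y‖ ≤ ∏ i, ‖Complex.I - ((inner ℝ (b i) y : ℝ) : ℂ)‖ := fun y => by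
    refine le_of_sq_le_sq ?_ (Finset.prod_nonneg fun _ _ => norm_nonneg _)
    rw [← Finset.prod_pow, ← b.sum_sq_norm_inner_right y]
    simp only [hb, Real.norm_eq_abs, sq_abs]
    have key : ∀ s : Finset ι, 1 + ∑ i ∈ s, inner ℝ (b i) y ^ 2 ≤
        ∏ i ∈ s, (1 + inner ℝ (b i) y ^ 2) := fun s => by
      classical
      induction s using Finset.induction_on with
      | empty => simp
      | insert i s hi ih =>
        rw [Finset.sum_insert hi, Finset.prod_insert hi]
        have h0 : 0 ≤ ∑ i ∈ s, inner ℝ (b i) y ^ 2 := Finset.sum_nonneg fun _ _ => sq_nonneg _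
        nlinarith [sq_nonneg (inner ℝ (b i) y)]
    linarith [key Finset.univ]
  have hq := tendsto_atTop_mono hle (tendsto_norm_cocompact_atTop (E := E))
  rw [tendsto_zero_iff_norm_tendsto_zero]
  refine hq.inv_tendsto_atTop.congr fun y => ?_
  simp [norm_prod, Finset.prod_inv_distrib]

/-- Functions `g ∘ P` with `g` continuous and vanishing at infinity and `P` linear lie in the
resolvent algebra. -/
theorem exists_mem_resolventAlgebra_of_tendsto_zero (P : X →L[ℝ] E) (g : C(E, ℂ))
    (h0 : Tendsto g (cocompact E) (𝓝 0)) :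
    ∃ f ∈ resolventAlgebra X, ∀ w, f w = g (P w) := by
  let j : C(X, OnePoint E) := ⟨fun w => (P w : OnePoint E),
    OnePoint.continuous_coe.comp P.continuous⟩
  let mk : C(OnePoint E, ℂ) →⋆ₐ[ℂ] (OnePoint E →ᵇ ℂ) :=
    { toFun := BoundedContinuousFunction.mkOfCompact
      map_one' := rfl
      map_mul' := fun _ _ => rfl
      map_zero' := rfl
      map_add' := fun _ _ => rfl
      commutes' := fun _ => rfl
      map_star' := fun _ => rfl }
  let φ := (compContinuousStarAlgHom j).comp mk
  have hφ : Continuous φ :=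
    (BoundedContinuousFunction.continuous_compContinuous j).comp
      (ContinuousMap.isometryEquivBoundedOfCompact (OnePoint E) ℂ).isometry.continuous
  -- The functions on the one-point compactification whose pullback along `P` lies in the algebra;
  -- this closed subalgebra turns out to be everything.
  let A := (resolventAlgebra X).comap φ
  have hA : IsClosed (A : Set C(OnePoint E, ℂ)) := isClosed_resolventAlgebra.preimage hφ
  let b := stdOrthonormalBasis ℝ E
  have hne : ∀ s : ℝ, Complex.I - (s : ℂ) ≠ 0 := fun s h => by
    simpa using congrArg Complex.im h
  let r : Fin (Module.finrank ℝ E) → C(E, ℂ) := fun i =>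
    ⟨fun y => 1 / (Complex.I - ((inner ℝ (b i) y : ℝ) : ℂ)),
      Continuous.div continuous_const (by fun_prop) fun y => hne _⟩
  have hr1 : ∀ i y, ‖r i y‖ ≤ 1 := by
    intro i y
    simp only [r, ContinuousMap.coe_mk, norm_div, norm_one]
    refine div_le_one_of_le₀ ?_ (norm_nonneg _)
    simpa using Complex.abs_im_le_norm (Complex.I - ((inner ℝ (b i) y : ℝ) : ℂ))
  let p : C(E, ℂ) := ∏ i, r i
  have hp : ∀ y, p y = ∏ i, r i y := fun y => by simp [p, ContinuousMap.prod_apply]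
  have hp0 : Tendsto p (cocompact E) (𝓝 0) := by
    refine (tendsto_prod_resolvent_cocompact _ b).congr fun y => (hp y).symm
  have hrp0 : ∀ i, Tendsto (r i * p) (cocompact E) (𝓝 0) := fun i => by
    refine squeeze_zero_norm (fun y => ?_) (tendsto_zero_iff_norm_tendsto_zero.1 hp0)
    rw [ContinuousMap.mul_apply, norm_mul]
    exact mul_le_of_le_one_left (norm_nonneg _) (hr1 i y)
  have hcc : coclosedCompact E = cocompact E := coclosedCompact_eq_cocompact
  -- The nowhere vanishing `p` separates `∞` from finite points. Where two finite points have the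
  -- same `p`, some `r i * p` separates them, as the `r i` determine the coordinates.
  let u : C(OnePoint E, ℂ) := OnePoint.continuousMapMk p 0 (by rwa [hcc])
  let v : Fin (Module.finrank ℝ E) → C(OnePoint E, ℂ) := fun i =>
    OnePoint.continuousMapMk (r i * p) 0 (by rw [hcc]; exact hrp0 i)
  let ρ : Fin (Module.finrank ℝ E) → (X →ᵇ ℂ) := fun i =>
    classicalResolvent (ContinuousLinearMap.adjoint P (b i)) 1 one_ne_zero
  have hρ : ∀ i w, ρ i w = r i (P w) := fun i w => by
    simp [ρ, r, classicalResolvent_apply, ContinuousLinearMap.adjoint_inner_left]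
  have hρm : ∀ i, ρ i ∈ resolventAlgebra X := fun i => classicalResolvent_mem _ _ _
  have hprod : ∀ w, (∏ i, ρ i) w = p (P w) := fun w => by
    rw [BoundedContinuousFunction.coe_prod, Finset.prod_apply, hp]
    exact Finset.prod_congr rfl fun i _ => hρ i w
  have hu : u ∈ A := by
    change φ u ∈ resolventAlgebra X
    have : φ u = ∏ i, ρ i := by
      ext w
      rw [hprod]
      rfl
    rw [this]
    exact prod_mem fun i _ => hρm i
  have hv : ∀ i, v i ∈ A := fun i => by
    change φ (v i) ∈ resolventAlgebra X
    have : φ (v i) = ρ i * ∏ i, ρ i := by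
      ext w
      rw [BoundedContinuousFunction.mul_apply, hprod, hρ]
      rfl
    rw [this]
    exact mul_mem (hρm i) (prod_mem fun i _ => hρm i)
  have hpne : ∀ y, p y ≠ 0 := fun y => by
    rw [hp]
    exact Finset.prod_ne_zero_iff.2 fun i _ => one_div_ne_zero (hne _)
  have hsep : A.SeparatesPoints := by
    intro x y hxy
    induction x using OnePoint.rec with
    | infty =>
      induction y using OnePoint.rec with
      | infty => exact absurd rfl hxy
      | coe y => exact ⟨u, ⟨u, hu, rfl⟩, fun h => hpne y h.symm⟩
    | coe x =>
      induction y using OnePoint.rec with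
      | infty => exact ⟨u, ⟨u, hu, rfl⟩, fun h => hpne x h⟩
      | coe y =>
        by_cases huxy : p x = p y
        · obtain ⟨i, hi⟩ : ∃ i, inner ℝ (b i) x ≠ inner ℝ (b i) y := by
            by_contra! hcon
            refine hxy (congrArg _ (b.repr.injective ?_))
            ext i
            rw [b.repr_apply_apply, b.repr_apply_apply, hcon i]
          refine ⟨v i, ⟨v i, hv i, rfl⟩, fun h => hi ?_⟩
          have h' : r i x * p x = r i y * p y := h
          rw [huxy] at h'
          have h'' := mul_right_cancel₀ (hpne y) h'
          simp only [r, ContinuousMap.coe_mk, one_div, inv_inj, sub_right_inj] at h''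
          exact_mod_cast h''
        · exact ⟨u, ⟨u, hu, rfl⟩, huxy⟩
  have htop : A = ⊤ := by
    rw [← ContinuousMap.starSubalgebra_topologicalClosure_eq_top_of_separatesPoints A hsep]
    exact (le_antisymm (StarSubalgebra.topologicalClosure_minimal le_rfl hA)
      (StarSubalgebra.le_topologicalClosure A)).symm
  let G : C(OnePoint E, ℂ) := OnePoint.continuousMapMk g 0 (by rwa [hcc])
  have hG : G ∈ A := by rw [htop]; trivial
  exact ⟨φ G, hG, fun w => rfl⟩

end

/-! ### The linear flow and time averages along it. -/

section

variable {X : Type*} [NormedAddCommGroup X] [InnerProductSpace ℝ X]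

/-- The flow `e^{sA}` of the linear vector field `A`. -/
def linearFlow (A : X →L[ℝ] X) (s : ℝ) : X →L[ℝ] X := NormedSpace.exp (s • A)

theorem linearFlow_zero (A : X →L[ℝ] X) : linearFlow A 0 = 1 := by
  simp [linearFlow]

variable [CompleteSpace X]

theorem linearFlow_mul_neg (A : X →L[ℝ] X) (s : ℝ) :
    linearFlow A s * linearFlow A (-s) = 1 := by
  let _ : NormedAlgebra ℚ (X →L[ℝ] X) := NormedAlgebra.restrictScalars ℚ ℝ _
  have h : Commute (s • A) (-s • A) := ((Commute.refl A).smul_left s).smul_right (-s)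
  rw [linearFlow, linearFlow, ← NormedSpace.exp_add_of_commute h]
  simp

theorem linearFlow_apply_neg (A : X →L[ℝ] X) (s : ℝ) (w : X) :
    linearFlow A s (linearFlow A (-s) w) = w :=
  congrArg (fun T : X →L[ℝ] X => T w) (linearFlow_mul_neg A s)

theorem hasDerivAt_linearFlow (A : X →L[ℝ] X) (s : ℝ) :
    HasDerivAt (linearFlow A) (A * linearFlow A s) s :=
  hasDerivAt_exp_smul_const' A s

theorem continuous_linearFlow (A : X →L[ℝ] X) : Continuous (linearFlow A) :=
  continuous_iff_continuousAt.2 fun s => (hasDerivAt_linearFlow A s).continuousAt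

/-- Analyticity in time makes an orbit's visits to a kernel either permanent or negligible. -/
theorem analyticAt_linearFlow (A : X →L[ℝ] X) (s : ℝ) : AnalyticAt ℝ (linearFlow A) s := by
  have h : AnalyticAt ℝ (fun s : ℝ => s • A) s := analyticAt_id.smul analyticAt_const
  exact AnalyticAt.comp (g := NormedSpace.exp) (f := fun s : ℝ => s • A)
    (NormedSpace.exp_analytic (𝕂 := ℝ) (s • A)) h

end

theorem exists_norm_le_of_tendsto_zero {E F : Type*} [TopologicalSpace E] [NormedAddCommGroup F]
    {g : E → F} (hg : Continuous g) (h0 : Tendsto g (cocompact E) (𝓝 0)) :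
    ∃ C : ℝ, 0 ≤ C ∧ ∀ y, ‖g y‖ ≤ C := by
  obtain ⟨C, hC⟩ := isBounded_iff_forall_norm_le.1
    (ZeroAtInftyContinuousMap.isBounded_range (⟨⟨g, hg⟩, h0⟩ : ZeroAtInftyContinuousMap E F))
  exact ⟨max C 0, le_max_right _ _, fun y => (hC _ ⟨y, rfl⟩).trans (le_max_left _ _)⟩

section

variable {X E : Type*} [NormedAddCommGroup X] [InnerProductSpace ℝ X] [FiniteDimensional ℝ X]
  [NormedAddCommGroup E] [InnerProductSpace ℝ E] [FiniteDimensional ℝ E]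

/-- Along a sequence escaping to infinity, compactness of the unit ball gives a subsequence whose
directions converge to a unit vector `d`. For almost every `s` one has `M s d ≠ 0`, so the arguments
of `G s` escape too; dominated convergence concludes. -/
theorem tendsto_intervalIntegral_cocompact {W : Submodule ℝ X} {G : ℝ → E → ℝ} {M : ℝ → X →L[ℝ] E}
    (hG : Continuous fun p : ℝ × E => G p.1 p.2) (hM : Continuous M) (τ : ℝ)
    {bound : ℝ → ℝ} (hbound : Continuous bound) (hGb : ∀ s y, ‖G s y‖ ≤ bound s)
    (hG0 : ∀ s, Tendsto (G s) (cocompact E) (𝓝 0))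
    (hMW : ∀ d ∈ W, d ≠ 0 → ∀ᵐ s : ℝ, M s d ≠ 0) :
    Tendsto (fun v : W => ∫ s in (0 : ℝ)..τ, G s (M s v)) (cocompact W) (𝓝 0) := by
  have : (cocompact W).IsCountablyGenerated := by
    rw [← Metric.cobounded_eq_cocompact, ← comap_norm_atTop]
    infer_instance
  refine tendsto_of_subseq_tendsto fun u hu => ?_
  have hun : Tendsto (fun n => ‖u n‖) atTop atTop := (tendsto_norm_cocompact_atTop (E := W)).comp hu
  obtain ⟨d, -, φ, hφ, hd⟩ := (isCompact_closedBall (0 : W) 1).tendsto_subseq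
    (x := fun n => ‖u n‖⁻¹ • u n) fun n => by
      rw [mem_closedBall_zero_iff, norm_smul, norm_inv, norm_norm]
      exact inv_mul_le_one
  have hunφ := hun.comp hφ.tendsto_atTop
  have hd1 : ‖d‖ = 1 := by
    refine tendsto_nhds_unique hd.norm (tendsto_const_nhds.congr' ?_)
    filter_upwards [hunφ.eventually_gt_atTop 0] with n hn
    simp only [Function.comp_apply] at hn ⊢
    rw [norm_smul, norm_inv, norm_norm, inv_mul_cancel₀ hn.ne']
  have hd0 : (d : X) ≠ 0 := by
    intro h
    rw [Submodule.coe_eq_zero.1 h, norm_zero] at hd1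
    exact zero_ne_one hd1
  refine ⟨φ, ?_⟩
  have hcont : ∀ w : X, Continuous fun s => G s (M s w) := fun w =>
    hG.comp (continuous_id.prodMk (hM.clm_apply continuous_const))
  have key := intervalIntegral.tendsto_integral_filter_of_dominated_convergence
    (μ := MeasureTheory.volume) (a := 0) (b := τ) (l := atTop)
    (F := fun n s => G s (M s (u (φ n)))) (f := fun _ => (0 : ℝ)) bound
    (Eventually.of_forall fun n => (hcont _).aestronglyMeasurable)
    (Eventually.of_forall fun n => Eventually.of_forall fun s _ => hGb _ _)
    (hbound.intervalIntegrable _ _) ?_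
  · simpa using key
  filter_upwards [hMW d d.2 hd0] with s hs _
  refine (hG0 s).comp ?_
  rw [← Metric.cobounded_eq_cocompact, ← tendsto_norm_atTop_iff_cobounded]
  have hlim : Tendsto (fun n => ‖M s ((‖u (φ n)‖⁻¹ • u (φ n) : W) : X)‖) atTop (𝓝 ‖M s d‖) :=
    (((M s).continuous.comp continuous_subtype_val).norm.tendsto d).comp hd
  refine (hunφ.atTop_mul_pos (norm_pos_iff.2 hs) hlim).congr' ?_
  filter_upwards [hunφ.eventually_gt_atTop 0] with n hn
  simp only [Function.comp_apply] at hn ⊢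
  rw [Submodule.coe_smul, map_smul, norm_smul, norm_inv, norm_norm, ← mul_assoc,
    mul_inv_cancel₀ hn.ne', one_mul]

/-- Time averages along a linear flow of a decaying vector field have components in the resolvent
algebra. -/
theorem exists_mem_resolventAlgebra_average (A : X →L[ℝ] X) (L : X →L[ℝ] E) {G : E → X}
    (hG : Continuous G) (h0 : Tendsto G (cocompact E) (𝓝 0)) (x : X) (τ : ℝ) :
    ∃ f ∈ resolventAlgebra X, ∀ w, f w =
      ((∫ s in (0 : ℝ)..τ, inner ℝ x (linearFlow A (-s) (G (L (linearFlow A s w)))) : ℝ) : ℂ) := by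
  obtain ⟨C, hC0, hC⟩ := exists_norm_le_of_tendsto_zero hG h0
  have hcl := continuous_linearFlow A
  let M : ℝ → X →L[ℝ] E := fun s => L.comp (linearFlow A s)
  have hM : Continuous M := continuous_const.clm_comp hcl
  let g : ℝ → E → ℝ := fun s y => inner ℝ x (linearFlow A (-s) (G y))
  have hg : Continuous fun p : ℝ × E => g p.1 p.2 :=
    continuous_const.inner ((hcl.comp continuous_fst.neg).clm_apply (hG.comp continuous_snd))
  -- The common kernel: the average depends only on the component of `w` in its orthogonal
  -- complement.
  let N : Submodule ℝ X := ⨅ s, LinearMap.ker (M s).toLinearMap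
  have hN : ∀ d, d ∈ N ↔ ∀ s, M s d = 0 := fun d => by simp [N, Submodule.mem_iInf]
  let J : X → ℝ := fun w => ∫ s in (0 : ℝ)..τ, g s (M s w)
  have hJ : Continuous J :=
    intervalIntegral.continuous_parametric_intervalIntegral_of_continuous'
      (f := fun w s => g s (M s w))
      (hg.comp (continuous_snd.prodMk ((hM.comp continuous_snd).clm_apply continuous_fst))) 0 τ
  have hJ0 : Tendsto (fun v : Nᗮ => J v) (cocompact Nᗮ) (𝓝 0) := by
    refine tendsto_intervalIntegral_cocompact hg hM τ
      (bound := fun s => ‖x‖ * (‖linearFlow A (-s)‖ * C)) (by fun_prop) (fun s y => ?_)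
      (fun s => ?_) fun d hd hd0 => ?_
    · refine (norm_inner_le_norm _ _).trans ?_
      gcongr
      exact (ContinuousLinearMap.le_opNorm _ _).trans (by gcongr; exact hC y)
    · have : Continuous fun z : X => inner ℝ x (linearFlow A (-s) z) := by fun_prop
      have h := (this.tendsto 0).comp h0
      rw [map_zero, inner_zero_right] at h
      exact h
    · have han : AnalyticOnNhd ℝ (fun s => M s d) Set.univ := fun s _ => by
        have h1 := (ContinuousLinearMap.analyticAt (L.comp
          (ContinuousLinearMap.apply ℝ X d)) (linearFlow A s)).comp (analyticAt_linearFlow A s)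
        exact h1
      rcases han.eqOn_zero_or_eventually_ne_zero_of_preconnected isPreconnected_univ with h | h
      · have hdN : d ∈ N := (hN d).2 fun s => h (Set.mem_univ s)
        exact absurd (inner_self_eq_zero.1 (hd d hdN)) hd0
      · have := ae_restrict_le_codiscreteWithin (μ := MeasureTheory.volume)
          MeasurableSet.univ h
        rwa [MeasureTheory.Measure.restrict_univ] at this
  obtain ⟨f, hf, hfw⟩ := exists_mem_resolventAlgebra_of_tendsto_zero
    (Nᗮ.orthogonalProjectionOnto) (⟨fun v => ((J v : ℝ) : ℂ), by fun_prop⟩ : C(Nᗮ, ℂ))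
    (by
      have h := (Complex.continuous_ofReal.tendsto 0).comp hJ0
      rw [Complex.ofReal_zero] at h
      exact h)
  refine ⟨f, hf, fun w => ?_⟩
  rw [hfw]
  have hmem : w - Nᗮ.orthogonalProjectionOnto w ∈ N := by
    have := Submodule.sub_starProjection_mem_orthogonal (K := Nᗮ) w
    rwa [Submodule.orthogonal_orthogonal] at this
  have hMeq : ∀ s, M s (Nᗮ.orthogonalProjectionOnto w) = M s w := fun s => by
    have := (hN _).1 hmem s
    rw [map_sub, sub_eq_zero] at this
    exact this.symm
  simp only [ContinuousMap.coe_mk, J, hMeq]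
  rfl

end

/-! ### Global flow and its approximation by a splitting scheme. -/

section

variable {X : Type*} [NormedAddCommGroup X] [InnerProductSpace ℝ X]
  {A : X →L[ℝ] X} {F : X → X} {K : ℝ≥0}

theorem lipschitzWith_clm_add (A : X →L[ℝ] X) (hF : LipschitzWith K F) :
    LipschitzWith (‖A‖₊ + K) fun w => A w + F w :=
  A.lipschitz.add hF

theorem solution_unique (A : X →L[ℝ] X) (hF : LipschitzWith K F) {γ δ : ℝ → X}
    (hγ : ∀ t, HasDerivAt γ (A (γ t) + F (γ t)) t) (hδ : ∀ t, HasDerivAt δ (A (δ t) + F (δ t)) t)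
    (h : γ 0 = δ 0) : γ = δ :=
  ODE_solution_unique_univ (v := fun _ w => A w + F w) (s := fun _ => Set.univ) (t₀ := 0)
    (fun _ => (lipschitzWith_clm_add A hF).lipschitzOnWith)
    (fun t => ⟨hγ t, trivial⟩) (fun t => ⟨hδ t, trivial⟩) h

theorem flow_add (A : X →L[ℝ] X) (hF : LipschitzWith K F) {Φ : ℝ → X → X} (hΦ0 : ∀ w, Φ 0 w = w)
    (hΦ : ∀ w t, HasDerivAt (fun t => Φ t w) (A (Φ t w) + F (Φ t w)) t) (s t : ℝ) (w : X) :
    Φ (s + t) w = Φ s (Φ t w) := by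
  have h := solution_unique A hF (γ := fun s => Φ (s + t) w) (δ := fun s => Φ s (Φ t w))
    (fun s => (hΦ w (s + t)).comp_add_const s t) (fun s => hΦ (Φ t w) s)
    (by simp [hΦ0])
  exact congrFun h s

theorem dist_flow_le (A : X →L[ℝ] X) (hF : LipschitzWith K F) {γ δ : ℝ → X}
    (hγ : ∀ t, HasDerivAt γ (A (γ t) + F (γ t)) t) (hδ : ∀ t, HasDerivAt δ (A (δ t) + F (δ t)) t)
    {t : ℝ} (ht : 0 ≤ t) :
    dist (γ t) (δ t) ≤ dist (γ 0) (δ 0) * Real.exp ((‖A‖₊ + K : ℝ≥0) * t) := by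
  have := dist_le_of_trajectories_ODE (v := fun _ w => A w + F w) (a := 0) (b := t)
    (fun _ => lipschitzWith_clm_add A hF)
    (HasDerivAt.continuousOn fun s _ => hγ s) (fun s _ => (hγ s).hasDerivWithinAt)
    (HasDerivAt.continuousOn fun s _ => hδ s) (fun s _ => (hδ s).hasDerivWithinAt)
    le_rfl t ⟨ht, le_rfl⟩
  rwa [sub_zero] at this

variable [FiniteDimensional ℝ X]

theorem exists_norm_linearFlow_le (A : X →L[ℝ] X) (T : ℝ) :
    ∃ B : ℝ≥0, ∀ s ∈ Set.Icc (-T) T, ‖linearFlow A s‖ ≤ B := by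
  obtain ⟨C, hC⟩ := isCompact_Icc.exists_bound_of_continuousOn (s := Set.Icc (-T) T)
    (continuous_linearFlow A).continuousOn
  exact ⟨⟨max C 0, le_max_right _ _⟩, fun s hs => (hC s hs).trans (le_max_left _ _)⟩

/-- Solutions on bounded time intervals, via the interaction picture. -/
theorem exists_solution_Ioo (A : X →L[ℝ] X) (hF : LipschitzWith K F) {C : ℝ≥0}
    (hC : ∀ w, ‖F w‖ ≤ C) (w : X) {T : ℝ} (hT : 0 < T) :
    ∃ α : ℝ → X, α 0 = w ∧ ∀ t ∈ Set.Ioo (-T) T, HasDerivAt α (A (α t) + F (α t)) t := by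
  obtain ⟨B, hB⟩ := exists_norm_linearFlow_le A T
  have hB' : ∀ s ∈ Set.Icc (-T) T, ‖linearFlow A (-s)‖ ≤ B := fun s hs =>
    hB _ ⟨by linarith [hs.2], by linarith [hs.1]⟩
  have hcl := continuous_linearFlow A
  have hFc := hF.continuous
  have h0 : (0 : ℝ) ∈ Set.Icc (-T) T := ⟨by linarith, hT.le⟩
  -- The equation for `e^{-tA} α(t)` has a field bounded by `B C`, so a ball of radius `B C T`
  -- serves the whole interval at once.
  have hPL : IsPicardLindelof (fun t y => linearFlow A (-t) (F (linearFlow A t y)))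
      (⟨0, h0⟩ : Set.Icc (-T) T) w (B * C * ⟨T, hT.le⟩) 0 (B * C) (B * (K * B)) := by
    refine ⟨fun t ht => ?_, fun x _ => ?_, fun t ht x _ => ?_, ?_⟩
    · have h1 : LipschitzWith B (linearFlow A t) :=
        (linearFlow A t).lipschitz.weaken (by exact_mod_cast hB t ht)
      have h2 : LipschitzWith B (linearFlow A (-t)) :=
        (linearFlow A (-t)).lipschitz.weaken (by exact_mod_cast hB' t ht)
      exact (h2.comp (hF.comp h1)).lipschitzOnWith
    · exact ((hcl.comp continuous_neg).clm_apply
        (hFc.comp (hcl.clm_apply continuous_const))).continuousOn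
    · refine (ContinuousLinearMap.le_opNorm _ _).trans ?_
      push_cast
      gcongr
      · exact hB' t ht
      · exact hC _
    · simp only [sub_zero, zero_sub, neg_neg, max_self, NNReal.coe_zero, NNReal.coe_mul]
      exact le_rfl
  obtain ⟨β, hβ0, hβ⟩ := hPL.exists_eq_forall_mem_Icc_hasDerivWithinAt₀
  refine ⟨fun t => linearFlow A t (β t), ?_, fun t ht => ?_⟩
  · change linearFlow A 0 (β 0) = w
    rw [linearFlow_zero]
    exact hβ0
  · have h1 := (hβ t (Set.Ioo_subset_Icc_self ht)).hasDerivAt (Icc_mem_nhds ht.1 ht.2)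
    have h2 := (hasDerivAt_linearFlow A t).clm_apply h1
    rw [linearFlow_apply_neg] at h2
    exact h2

/-- A bounded Lipschitz perturbation of a linear vector field has a global flow. -/
theorem exists_flow (A : X →L[ℝ] X) (hF : LipschitzWith K F) {C : ℝ≥0} (hC : ∀ w, ‖F w‖ ≤ C) :
    ∃ Φ : ℝ → X → X, (∀ w, Φ 0 w = w) ∧
      ∀ w t, HasDerivAt (fun t => Φ t w) (A (Φ t w) + F (Φ t w)) t := by
  have hpos : ∀ n : ℕ, (0 : ℝ) < n + 1 := fun n => by positivity
  choose α hα0 hα using fun (w : X) (n : ℕ) => exists_solution_Ioo A hF hC w (hpos n)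
  have hlip := lipschitzWith_clm_add A hF
  have hsub : ∀ {n m : ℕ} {t : ℝ}, n ≤ m → t ∈ Set.Ioo (-((n : ℝ) + 1)) (n + 1) →
      t ∈ Set.Ioo (-((m : ℝ) + 1)) (m + 1) := fun {n m t} h ht => by
    have : (n : ℝ) ≤ m := by exact_mod_cast h
    exact ⟨by linarith [ht.1], by linarith [ht.2]⟩
  have hle : ∀ w (n m : ℕ), n ≤ m → ∀ t ∈ Set.Ioo (-((n : ℝ) + 1)) (n + 1),
      α w n t = α w m t := fun w n m h =>
    ODE_solution_unique_of_mem_Ioo (v := fun _ w => A w + F w) (s := fun _ => Set.univ) (t₀ := 0)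
      (fun t _ => hlip.lipschitzOnWith) ⟨by linarith [hpos n], hpos n⟩
      (fun t ht => ⟨hα w n t ht, trivial⟩) (fun t ht => ⟨hα w m t (hsub h ht), trivial⟩)
      (by rw [hα0, hα0])
  have heq : ∀ w (n m : ℕ) (t : ℝ), t ∈ Set.Ioo (-((n : ℝ) + 1)) (n + 1) →
      t ∈ Set.Ioo (-((m : ℝ) + 1)) (m + 1) → α w n t = α w m t := fun w n m t hn hm => by
    rcases le_total n m with h | h
    · exact hle w n m h t hn
    · exact (hle w m n h t hm).symm
  have hceil : ∀ t : ℝ, t ∈ Set.Ioo (-((⌈|t|⌉₊ : ℝ) + 1)) (⌈|t|⌉₊ + 1) := fun t => by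
    rw [Set.mem_Ioo, ← abs_lt]
    linarith [Nat.le_ceil |t|]
  -- Each `t` is interior to its interval `(-(⌈|t|⌉₊ + 1), ⌈|t|⌉₊ + 1)`, and uniqueness reconciles
  -- nearby times that use another interval.
  refine ⟨fun t w => α w ⌈|t|⌉₊ t, fun w => hα0 _ _, fun w t => ?_⟩
  refine (hα w ⌈|t|⌉₊ t (hceil t)).congr_of_eventuallyEq ?_
  filter_upwards [Ioo_mem_nhds (hceil t).1 (hceil t).2] with s hs
  exact heq w _ _ s (hceil s) hs

/-- The time integral of the perturbation `F` along the linear flow of `A`, in the interaction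
picture. -/
def flowAverage (A : X →L[ℝ] X) (F : X → X) (τ : ℝ) (w : X) : X :=
  ∫ s in (0 : ℝ)..τ, linearFlow A (-s) (F (linearFlow A s w))

theorem continuous_flowAverage_integrand (A : X →L[ℝ] X) (hF : Continuous F) :
    Continuous fun p : X × ℝ => linearFlow A (-p.2) (F (linearFlow A p.2 p.1)) :=
  ((continuous_linearFlow A).comp continuous_snd.neg).clm_apply
    (hF.comp (((continuous_linearFlow A).comp continuous_snd).clm_apply continuous_fst))

theorem continuous_flowAverage (A : X →L[ℝ] X) (hF : Continuous F) (τ : ℝ) :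
    Continuous (flowAverage A F τ) :=
  intervalIntegral.continuous_parametric_intervalIntegral_of_continuous'
    (f := fun w s => linearFlow A (-s) (F (linearFlow A s w)))
    (continuous_flowAverage_integrand A hF) 0 τ

theorem hasDerivAt_flowAverage (A : X →L[ℝ] X) (hF : Continuous F) (w : X) (τ : ℝ) :
    HasDerivAt (fun τ => flowAverage A F τ w) (linearFlow A (-τ) (F (linearFlow A τ w))) τ := by
  have hc : Continuous fun s => linearFlow A (-s) (F (linearFlow A s w)) :=
    (continuous_flowAverage_integrand A hF).comp (continuous_const.prodMk continuous_id)
  exact intervalIntegral.integral_hasDerivAt_right (hc.intervalIntegrable _ _)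
    hc.aestronglyMeasurable.stronglyMeasurableAtFilter hc.continuousAt

/-- One step of the splitting scheme that approximates the flow of `A + F`. -/
def splittingStep (A : X →L[ℝ] X) (F : X → X) (τ : ℝ) (w : X) : X :=
  linearFlow A τ (w + flowAverage A F τ w)

/-- The splitting scheme has local error of second order, uniformly on the phase space. -/
theorem exists_dist_splittingStep_le (A : X →L[ℝ] X) (hF : LipschitzWith K F) {C : ℝ≥0}
    (hC : ∀ w, ‖F w‖ ≤ C) :
    ∃ D : ℝ, 0 ≤ D ∧ ∀ γ : ℝ → X, (∀ t, HasDerivAt γ (A (γ t) + F (γ t)) t) →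
      ∀ τ ∈ Set.Icc (0 : ℝ) 1, dist (γ τ) (splittingStep A F τ (γ 0)) ≤ D * τ ^ 2 := by
  obtain ⟨B, hB⟩ := exists_norm_linearFlow_le A 1
  -- The `+ 1` keeps the Grönwall constant non-zero.
  let K' : ℝ≥0 := ‖A‖₊ + K + 1
  have hK' : (0 : ℝ) < K' := by positivity
  refine ⟨K * (B * (B * C)) * Real.exp K', by positivity, fun γ hγ τ hτ => ?_⟩
  have hlip : LipschitzWith K' fun w => A w + F w :=
    (lipschitzWith_clm_add A hF).weaken (by simp [K'])
  have havg : ∀ s ∈ Set.Icc 0 τ, ‖flowAverage A F s (γ 0)‖ ≤ B * C * τ := fun s hs => by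
    have h1 : ‖flowAverage A F s (γ 0)‖ ≤ B * C * |s - 0| := by
      refine intervalIntegral.norm_integral_le_of_norm_le_const fun r hr => ?_
      rw [Set.uIoc_of_le hs.1] at hr
      refine (ContinuousLinearMap.le_opNorm _ _).trans ?_
      gcongr
      · exact hB _ ⟨by linarith [hr.2, hs.2, hτ.2], by linarith [hr.1]⟩
      · exact hC _
    refine h1.trans ?_
    rw [sub_zero, abs_of_nonneg hs.1]
    gcongr
    exact hs.2
  -- The step solves the equation up to the defect `F(e^{sA} w) - F(u)`, at most `K B · B C τ`
  -- because the arguments differ by `e^{sA}` of the average. Grönwall supplies the second factor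
  -- `τ`.
  have hu : ∀ s, HasDerivAt (fun s => splittingStep A F s (γ 0))
      (A (splittingStep A F s (γ 0)) + F (linearFlow A s (γ 0))) s := fun s => by
    have h := (hasDerivAt_linearFlow A s).clm_apply
      ((hasDerivAt_flowAverage A hF.continuous (γ 0) s).const_add (γ 0))
    rw [linearFlow_apply_neg] at h
    exact h
  have hG := dist_le_of_approx_trajectories_ODE (v := fun _ w => A w + F w) (a := 0) (b := τ)
    (δ := 0) (εf := 0) (εg := K * (B * (B * C * τ))) (fun _ => hlip)
    (HasDerivAt.continuousOn fun s _ => hγ s) (fun s _ => (hγ s).hasDerivWithinAt)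
    (fun s _ => (dist_self _).le)
    (HasDerivAt.continuousOn fun s _ => hu s) (fun s _ => (hu s).hasDerivWithinAt)
    (fun s hs => ?_) (by simp [splittingStep, flowAverage, linearFlow_zero]) τ ⟨hτ.1, le_rfl⟩
  · refine hG.trans ?_
    rw [gronwallBound_of_K_ne_0 hK'.ne', sub_zero, zero_add]
    have hexp : Real.exp (K' * τ) - 1 ≤ K' * τ * Real.exp K' := by
      have h1 : 1 - K' * τ ≤ Real.exp (-(K' * τ)) := Real.one_sub_le_exp_neg _
      have h2 : Real.exp (-(K' * τ)) * Real.exp (K' * τ) = 1 := by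
        rw [← Real.exp_add]; simp
      have h3 : Real.exp (K' * τ) ≤ Real.exp K' :=
        Real.exp_le_exp.2 (mul_le_of_le_one_right hK'.le hτ.2)
      have h4 : 0 ≤ K' * τ := mul_nonneg hK'.le hτ.1
      nlinarith [Real.exp_pos (K' * τ), mul_le_mul_of_nonneg_right h1 (Real.exp_pos (K' * τ)).le,
        mul_le_mul_of_nonneg_left h3 h4]
    have hε : 0 ≤ K * (B * (B * C * τ)) / (K' : ℝ) := by
      have := hτ.1
      positivity
    calc 0 * Real.exp (K' * τ) + K * (B * (B * C * τ)) / K' * (Real.exp (K' * τ) - 1)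
        ≤ K * (B * (B * C * τ)) / K' * (K' * τ * Real.exp K') := by
          rw [zero_mul, zero_add]
          exact mul_le_mul_of_nonneg_left hexp hε
      _ = K * (B * (B * C)) * Real.exp K' * τ ^ 2 := by
          field_simp
  · rw [dist_add_left]
    refine (hF.dist_le_mul _ _).trans ?_
    gcongr
    rw [splittingStep, map_add, dist_self_add_right]
    refine (ContinuousLinearMap.le_opNorm _ _).trans ?_
    gcongr
    · exact hB s ⟨by linarith [hs.1], by linarith [hs.2, hτ.2]⟩
    · exact havg s ⟨hs.1, hs.2.le⟩

/-- Local errors add up, each amplified at most exponentially by the flow. For `τ = T / N` the bound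
is `D T² e^{κT} / N`, uniformly in `w`. -/
theorem exists_dist_splittingStep_iterate_le (A : X →L[ℝ] X) (hF : LipschitzWith K F) {C : ℝ≥0}
    (hC : ∀ w, ‖F w‖ ≤ C) {Φ : ℝ → X → X} (hΦ0 : ∀ w, Φ 0 w = w)
    (hΦ : ∀ w t, HasDerivAt (fun t => Φ t w) (A (Φ t w) + F (Φ t w)) t) :
    ∃ D κ : ℝ, 0 ≤ D ∧ 0 ≤ κ ∧ ∀ τ ∈ Set.Icc (0 : ℝ) 1, ∀ (N : ℕ) (w : X),
      dist (Φ (N * τ) w) ((splittingStep A F τ)^[N] w) ≤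
        N * (D * τ ^ 2) * Real.exp (κ * (N * τ)) := by
  obtain ⟨D, hD, hstep⟩ := exists_dist_splittingStep_le A hF hC
  refine ⟨D, ((‖A‖₊ + K : ℝ≥0) : ℝ), hD, NNReal.coe_nonneg _, fun τ hτ N w => ?_⟩
  set κ : ℝ := ((‖A‖₊ + K : ℝ≥0) : ℝ) with hκ
  have hκ0 : 0 ≤ κ := NNReal.coe_nonneg _
  induction N with
  | zero => simp [hΦ0]
  | succ N ih =>
    rw [Function.iterate_succ_apply']
    set z := (splittingStep A F τ)^[N] w
    have e1 : Φ ((N + 1 : ℕ) * τ) w = Φ τ (Φ (N * τ) w) := by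
      rw [← flow_add A hF hΦ0 hΦ]
      congr 1
      push_cast
      ring
    have e2 := dist_flow_le A hF (hΦ (Φ (N * τ) w)) (hΦ z) hτ.1
    have e3 := hstep (fun t => Φ t z) (hΦ z) τ hτ
    simp only [hΦ0] at e2 e3
    rw [e1]
    have hE : Real.exp (κ * ((N + 1 : ℕ) * τ)) = Real.exp (κ * (N * τ)) * Real.exp (κ * τ) := by
      rw [← Real.exp_add]
      congr 1
      push_cast
      ring
    have h1 : 1 ≤ Real.exp (κ * ((N + 1 : ℕ) * τ)) :=
      Real.one_le_exp (mul_nonneg hκ0 (mul_nonneg (Nat.cast_nonneg _) hτ.1))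
    have h2 : 0 ≤ D * τ ^ 2 := by positivity
    calc dist (Φ τ (Φ (N * τ) w)) (splittingStep A F τ z)
        ≤ dist (Φ τ (Φ (N * τ) w)) (Φ τ z) + dist (Φ τ z) (splittingStep A F τ z) :=
          dist_triangle _ _ _
      _ ≤ N * (D * τ ^ 2) * Real.exp (κ * (N * τ)) * Real.exp (κ * τ) + D * τ ^ 2 :=
          add_le_add (e2.trans (by gcongr)) e3
      _ ≤ N * (D * τ ^ 2) * Real.exp (κ * ((N + 1 : ℕ) * τ)) +
            D * τ ^ 2 * Real.exp (κ * ((N + 1 : ℕ) * τ)) := by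
          rw [mul_assoc _ (Real.exp _), ← hE]
          exact add_le_add le_rfl (le_mul_of_one_le_right h2 h1)
      _ = (N + 1 : ℕ) * (D * τ ^ 2) * Real.exp (κ * ((N + 1 : ℕ) * τ)) := by
          push_cast
          ring

theorem exists_mem_comp_splittingStep (hF : Continuous F)
    (havg : ∀ (x : X) (τ : ℝ), ∃ f ∈ resolventAlgebra X, ∀ w,
      f w = ((inner ℝ x (flowAverage A F τ w) : ℝ) : ℂ)) (τ : ℝ) {f : X →ᵇ ℂ}
    (hf : f ∈ resolventAlgebra X) :
    ∃ f' ∈ resolventAlgebra X, ∀ w, f' w = f (splittingStep A F τ w) :=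
  ⟨_, compContinuous_id_add_mem (flowAverage A F τ) (continuous_flowAverage A hF τ)
    (fun x => havg x τ) (compContinuous_clm_mem (linearFlow A τ) hf), fun _ => rfl⟩

theorem exists_mem_comp_splittingStep_iterate (hF : Continuous F)
    (havg : ∀ (x : X) (τ : ℝ), ∃ f ∈ resolventAlgebra X, ∀ w,
      f w = ((inner ℝ x (flowAverage A F τ w) : ℝ) : ℂ)) (τ : ℝ) (N : ℕ) {f : X →ᵇ ℂ}
    (hf : f ∈ resolventAlgebra X) :
    ∃ f' ∈ resolventAlgebra X, ∀ w, f' w = f ((splittingStep A F τ)^[N] w) := by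
  induction N with
  | zero => exact ⟨f, hf, fun _ => rfl⟩
  | succ N ih =>
    obtain ⟨g, hg, hgw⟩ := ih
    obtain ⟨g', hg', hgw'⟩ := exists_mem_comp_splittingStep hF havg τ hg
    exact ⟨g', hg', fun w => by rw [hgw', hgw, Function.iterate_succ_apply]⟩

/-- The forward flow of `A + F` preserves the resolvent algebra. -/
theorem compContinuous_flow_mem (A : X →L[ℝ] X) (hF : LipschitzWith K F) {C : ℝ≥0}
    (hC : ∀ w, ‖F w‖ ≤ C)
    (havg : ∀ (x : X) (τ : ℝ), ∃ f ∈ resolventAlgebra X, ∀ w,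
      f w = ((inner ℝ x (flowAverage A F τ w) : ℝ) : ℂ))
    {Φ : ℝ → X → X} (hΦ0 : ∀ w, Φ 0 w = w)
    (hΦ : ∀ w t, HasDerivAt (fun t => Φ t w) (A (Φ t w) + F (Φ t w)) t) {T : ℝ} (hT : 0 ≤ T)
    (g : C(X, X)) (hg : ∀ w, g w = Φ T w) {f : X →ᵇ ℂ} (hf : f ∈ resolventAlgebra X) :
    f.compContinuous g ∈ resolventAlgebra X := by
  obtain ⟨D, κ, hD, hκ, hbound⟩ := exists_dist_splittingStep_iterate_le A hF hC hΦ0 hΦ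
  rw [← SetLike.mem_coe, ← isClosed_resolventAlgebra.closure_eq, Metric.mem_closure_iff]
  intro ε hε
  obtain ⟨δ, hδ, hfδ⟩ := Metric.uniformContinuous_iff.1
    (uniformContinuous_of_mem_resolventAlgebra hf) (ε / 2) (by positivity)
  have hlim : Tendsto (fun N : ℕ => D * T ^ 2 * Real.exp (κ * T) / N) atTop (𝓝 0) :=
    tendsto_const_div_atTop_nhds_zero_nat _
  -- `N ≥ T` ensures a step length at most 1, as the local error bound requires.
  obtain ⟨N, hN1, hN2, hN3⟩ := ((hlim.eventually_lt_const hδ).and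
    ((tendsto_natCast_atTop_atTop (R := ℝ)).eventually_ge_atTop T |>.and
      (eventually_gt_atTop 0))).exists
  have hN : (0 : ℝ) < N := by exact_mod_cast hN3
  obtain ⟨f', hf', hfw⟩ := exists_mem_comp_splittingStep_iterate hF.continuous havg (T / N) N hf
  refine ⟨f', hf', ?_⟩
  refine lt_of_le_of_lt ((BoundedContinuousFunction.dist_le (by positivity)).2 fun w => ?_)
    (half_lt_self hε)
  rw [BoundedContinuousFunction.compContinuous_apply, hfw, hg]
  refine (hfδ ?_).le
  have h := hbound (T / N) ⟨by positivity, (div_le_one hN).2 hN2⟩ N w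
  rw [mul_div_cancel₀ T hN.ne'] at h
  refine h.trans_lt (lt_of_eq_of_lt ?_ hN1)
  field_simp

end

/-! ### The abstract theorem for linear fields with decaying perturbations. -/

theorem exists_lipschitzWith_sum {α ι E : Type*} [PseudoEMetricSpace α] [SeminormedAddCommGroup E]
    (s : Finset ι) {f : ι → α → E} (h : ∀ i, ∃ K, LipschitzWith K (f i)) :
    ∃ K, LipschitzWith K fun x => ∑ i ∈ s, f i x := by
  classical
  induction s using Finset.induction_on with
  | empty => exact ⟨0, by simpa using LipschitzWith.const (0 : E)⟩
  | insert i s hi ih =>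
    obtain ⟨K, hK⟩ := ih
    obtain ⟨K', hK'⟩ := h i
    exact ⟨K' + K, by simpa only [Finset.sum_insert hi] using hK'.add hK⟩

section

variable {X E ι : Type*} [NormedAddCommGroup X] [InnerProductSpace ℝ X] [FiniteDimensional ℝ X]
  [NormedAddCommGroup E] [InnerProductSpace ℝ E] [FiniteDimensional ℝ E] [Fintype ι]

theorem exists_mem_flowAverage (A : X →L[ℝ] X) (L : ι → X →L[ℝ] E) {G : ι → E → X}
    (hG : ∀ i, Continuous (G i)) (h0 : ∀ i, Tendsto (G i) (cocompact E) (𝓝 0)) (x : X) (τ : ℝ) :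
    ∃ f ∈ resolventAlgebra X, ∀ w,
      f w = ((inner ℝ x (flowAverage A (fun w => ∑ i, G i (L i w)) τ w) : ℝ) : ℂ) := by
  choose f hf hfw using fun i => exists_mem_resolventAlgebra_average A (L i) (hG i) (h0 i) x τ
  refine ⟨∑ i, f i, sum_mem fun i _ => hf i, fun w => ?_⟩
  have hc : ∀ i, Continuous fun s => linearFlow A (-s) (G i (L i (linearFlow A s w))) := fun i =>
    (continuous_flowAverage_integrand A ((hG i).comp (L i).continuous)).comp
      (continuous_const.prodMk continuous_id)
  have hsum : Continuous fun s => linearFlow A (-s) (∑ i, G i (L i (linearFlow A s w))) := by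
    simp only [map_sum]
    exact continuous_finsetSum _ fun i _ => hc i
  have key : inner ℝ x (flowAverage A (fun w => ∑ i, G i (L i w)) τ w) =
      ∑ i, ∫ s in (0 : ℝ)..τ, inner ℝ x (linearFlow A (-s) (G i (L i (linearFlow A s w)))) := by
    have h := (innerSL ℝ x).intervalIntegral_comp_comm (μ := MeasureTheory.volume)
      (hsum.intervalIntegrable 0 τ)
    simp only [innerSL_apply_apply] at h
    rw [flowAverage, ← h, ← intervalIntegral.integral_finsetSum fun i _ =>
      (continuous_const.inner (hc i)).intervalIntegrable _ _]
    simp only [map_sum, inner_sum]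
  rw [key, BoundedContinuousFunction.coe_sum, Finset.sum_apply]
  push_cast
  exact Finset.sum_congr rfl fun i _ => hfw i w

/-- The flow of a linear vector field perturbed by finitely many decaying Lipschitz vector fields,
each a function of a linear image of the phase space, preserves the resolvent algebra. -/
theorem exists_flow_preserving_resolventAlgebra (A : X →L[ℝ] X) (L : ι → X →L[ℝ] E)
    {G : ι → E → X} (hLip : ∀ i, ∃ K, LipschitzWith K (G i))
    (h0 : ∀ i, Tendsto (G i) (cocompact E) (𝓝 0)) :
    ∃ Φ : ℝ → X ≃ₜ X, (∀ w, Φ 0 w = w) ∧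
      (∀ w t, HasDerivAt (fun t => Φ t w) (A (Φ t w) + ∑ i, G i (L i (Φ t w))) t) ∧
      (∀ γ : ℝ → X, (∀ t, HasDerivAt γ (A (γ t) + ∑ i, G i (L i (γ t))) t) →
        ∀ t, γ t = Φ t (γ 0)) ∧
      (∀ t, ∀ w, Φ (-t) (Φ t w) = w) ∧
      ∀ t, ∀ f ∈ resolventAlgebra X,
        f.compContinuous (Φ t : C(X, X)) ∈ resolventAlgebra X := by
  have hGc : ∀ i, Continuous (G i) := fun i => (hLip i).choose_spec.continuous
  set F : X → X := fun w => ∑ i, G i (L i w) with hFdef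
  obtain ⟨K, hF⟩ : ∃ K, LipschitzWith K F := exists_lipschitzWith_sum _ fun i =>
    ⟨_, (hLip i).choose_spec.comp (L i).lipschitz⟩
  choose c hc0 hc using fun i => exists_norm_le_of_tendsto_zero (hGc i) (h0 i)
  have hC : ∀ w, ‖F w‖ ≤ (⟨∑ i, c i, Finset.sum_nonneg fun i _ => hc0 i⟩ : ℝ≥0) := fun w =>
    norm_sum_le_of_le _ fun i _ => hc i _
  obtain ⟨φ, hφ0, hφ⟩ := exists_flow A hF hC
  have hadd := flow_add A hF hφ0 hφ
  have hFn : ∀ w, ∑ i, (-G i) (L i w) = -F w := fun w => by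
    simp only [Pi.neg_apply, Finset.sum_neg_distrib, hFdef]
  -- The reversed flow is generated by `-A` and `-G`, which satisfy the same assumptions, so
  -- forward-time results cover negative times.
  have hneg : ∀ w t, HasDerivAt (fun t => φ (-t) w)
      ((-A) (φ (-t) w) + ∑ i, (-G i) (L i (φ (-t) w))) t := fun w t => by
    have h := (hφ w (-t)).scomp t (hasDerivAt_neg t)
    rw [hFn, neg_apply, ← neg_add, ← neg_one_smul ℝ]
    exact h
  have hFneg : LipschitzWith K fun w => ∑ i, (-G i) (L i w) := by
    simp only [hFn]
    exact hF.neg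
  have hCneg : ∀ w, ‖∑ i, (-G i) (L i w)‖ ≤
      (⟨∑ i, c i, Finset.sum_nonneg fun i _ => hc0 i⟩ : ℝ≥0) := fun w => by
    rw [hFn, norm_neg]
    exact hC w
  have hcont : ∀ t, Continuous (φ t) := by
    have hpos : ∀ (B : X →L[ℝ] X) {F' : X → X} {ψ : ℝ → X → X}, LipschitzWith K F' →
        (∀ w, ψ 0 w = w) → (∀ w t, HasDerivAt (fun t => ψ t w) (B (ψ t w) + F' (ψ t w)) t) →
        ∀ t, 0 ≤ t → Continuous (ψ t) := fun B F' ψ hF' hψ0 hψ t ht => by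
      refine (LipschitzWith.of_dist_le_mul (K := ⟨Real.exp ((‖B‖₊ + K : ℝ≥0) * t),
        (Real.exp_pos _).le⟩) fun x y => ?_).continuous
      have h := dist_flow_le B hF' (hψ x) (hψ y) ht
      simp only [hψ0] at h
      rw [mul_comm] at h
      exact h
    intro t
    rcases le_total 0 t with ht | ht
    · exact hpos A hF hφ0 hφ t ht
    · have h := hpos (-A) (ψ := fun t => φ (-t)) hFneg (fun w => by simp [hφ0]) hneg (-t)
        (by linarith)
      simpa using h
  have hinv : ∀ t w, φ (-t) (φ t w) = w := fun t w => by rw [← hadd, neg_add_cancel, hφ0]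
  let Φ : ℝ → X ≃ₜ X := fun t =>
    { toFun := φ t
      invFun := φ (-t)
      left_inv := hinv t
      right_inv := fun w => by simpa using hinv (-t) w
      continuous_toFun := hcont t
      continuous_invFun := hcont (-t) }
  refine ⟨Φ, hφ0, hφ, fun γ hγ t => ?_, hinv, fun t f hf => ?_⟩
  · exact congrFun (solution_unique A hF hγ (hφ (γ 0)) (hφ0 _).symm) t
  · rcases le_total 0 t with ht | ht
    · exact compContinuous_flow_mem A hF hC (exists_mem_flowAverage A L hGc h0) hφ0 hφ ht _
        (fun _ => rfl) hf
    · refine compContinuous_flow_mem (-A) hFneg hCneg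
        (exists_mem_flowAverage (-A) L (fun i => (hGc i).neg) fun i => by simpa using! (h0 i).neg)
        (Φ := fun t => φ (-t)) (fun w => by simp [hφ0]) hneg (T := -t) (by linarith) _
        (fun w => ?_) hf
      simp [Φ]

end

/-! ### Gradients: decay and calculus rules. -/

section

variable {E : Type*} [NormedAddCommGroup E] [InnerProductSpace ℝ E] [FiniteDimensional ℝ E]

/-- The gradient of a `C¹` function that vanishes at infinity also vanishes at infinity, provided
that it is Lipschitz. -/
theorem tendsto_gradient_cocompact {V : E → ℝ} (hV : Differentiable ℝ V)
    (h0 : Tendsto V (cocompact E) (𝓝 0)) {K : ℝ≥0} (hK : LipschitzWith K (gradient V)) :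
    Tendsto (gradient V) (cocompact E) (𝓝 0) := by
  rw [← Metric.cobounded_eq_cocompact, ← comap_norm_atTop] at *
  rw [Metric.tendsto_nhds]
  intro ε hε
  -- A displacement of length `δ` along the gradient changes `V` by `δ ‖∇V‖` up to `K δ² ≤ δ ε / 2`.
  -- Far out `V` changes by less than `2 · ε δ / 8`, which forces `‖∇V‖ < ε`.
  let δ : ℝ := ε / (2 * (K + 1))
  have hδ : 0 < δ := by positivity
  have hKδ : K * δ ≤ ε / 2 := by
    have : (K + 1) * δ = ε / 2 := by simp only [δ]; field_simp
    nlinarith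
  have hev := Metric.tendsto_nhds.1 h0 (ε * δ / 8) (by positivity)
  rw [eventually_comap] at hev ⊢
  obtain ⟨R, hR⟩ := eventually_atTop.1 hev
  refine eventually_atTop.2 ⟨R + δ, fun r hr x hx => ?_⟩
  rw [dist_zero_right]
  rcases eq_or_ne (gradient V x) 0 with hg | hg
  · rwa [hg, norm_zero]
  have hgpos : 0 < ‖gradient V x‖ := norm_pos_iff.2 hg
  let h : E := (δ / ‖gradient V x‖) • gradient V x
  have hh : ‖h‖ = δ := by
    simp only [h]
    rw [norm_smul, Real.norm_of_nonneg (by positivity), div_mul_cancel₀ _ hgpos.ne']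
  have hR1 : R ≤ ‖x‖ := by rw [hx]; linarith
  have hR2 : R ≤ ‖x + h‖ := by
    have := norm_sub_norm_le x (-h)
    rw [norm_neg, sub_neg_eq_add] at this
    linarith
  have hV1 := hR ‖x‖ hR1 x rfl
  have hV2 := hR ‖x + h‖ hR2 (x + h) rfl
  rw [dist_zero_right, Real.norm_eq_abs] at hV1 hV2
  have hmv : ‖V (x + h) - V x - innerSL ℝ (gradient V x) (x + h - x)‖ ≤ (K * δ) * ‖x + h - x‖ := by
    refine Convex.norm_image_sub_le_of_norm_hasFDerivWithin_le'
      (s := Metric.closedBall x δ) (f' := fun y => innerSL ℝ (gradient V y))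
      (fun y _ => ?_) (fun y hy => ?_) (convex_closedBall x δ)
      (Metric.mem_closedBall_self hδ.le) (by simp [hh])
    · exact ((hV y).hasGradientAt.hasFDerivAt).hasFDerivWithinAt
    · rw [← map_sub, innerSL_apply_norm, ← dist_eq_norm]
      refine (hK.dist_le_mul y x).trans ?_
      gcongr
      exact hy
  rw [add_sub_cancel_left, hh, innerSL_apply_apply] at hmv
  have hinner : inner ℝ (gradient V x) h = δ * ‖gradient V x‖ := by
    simp only [h]
    rw [inner_smul_right, real_inner_self_eq_norm_sq]
    field_simp
  rw [hinner, Real.norm_eq_abs, abs_le] at hmv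
  rw [abs_lt] at hV1 hV2
  have : δ * ‖gradient V x‖ < δ * ε := by nlinarith
  exact lt_of_mul_lt_mul_left this hδ.le

variable {X : Type*} [NormedAddCommGroup X] [InnerProductSpace ℝ X] [CompleteSpace X]

theorem HasGradientAt.comp_clm {V : E → ℝ} {g : E} (D : X →L[ℝ] E) {w : X}
    (h : HasGradientAt V g (D w)) :
    HasGradientAt (fun w => V (D w)) (ContinuousLinearMap.adjoint D g) w := by
  rw [hasGradientAt_iff_hasFDerivAt] at *
  convert! h.comp w D.hasFDerivAt using 1
  ext y
  simp [ContinuousLinearMap.adjoint_inner_left]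

theorem HasGradientAt.fun_add' {f g : X → ℝ} {f' g' w : X} (hf : HasGradientAt f f' w)
    (hg : HasGradientAt g g' w) : HasGradientAt (fun w => f w + g w) (f' + g') w := by
  rw [hasGradientAt_iff_hasFDerivAt] at *
  rw [map_add]
  exact hf.add hg

theorem hasGradientAt_finset_sum {ι : Type*} (s : Finset ι) {f : ι → X → ℝ} {f' : ι → X} {w : X}
    (h : ∀ i, HasGradientAt (f i) (f' i) w) :
    HasGradientAt (fun w => ∑ i ∈ s, f i w) (∑ i ∈ s, f' i) w := by
  simp only [hasGradientAt_iff_hasFDerivAt, map_sum] at *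
  exact HasFDerivAt.fun_sum fun i _ => h i

theorem hasGradientAt_const_mul_norm_sq (c : ℝ) (y : E) :
    HasGradientAt (fun y : E => c * ‖y‖ ^ 2) ((2 * c) • y) y := by
  rw [hasGradientAt_iff_hasFDerivAt]
  convert! (hasStrictFDerivAt_norm_sq y).hasFDerivAt.const_mul c using 1
  ext z
  simp
  ring

end

/-! ### The Hamiltonian vector field of the lattice system. -/

section

variable {Γ : Type*} {Λ : Finset Γ} {n : ℕ}

/-- The momentum of a particle as a linear map on phase space. -/
def momentumCLM (l : Λ) : PhaseSpace Λ n →L[ℝ] EuclideanSpace ℝ (Fin n) :=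
  LinearMap.toContinuousLinearMap
    { toFun := fun w => momentum w l
      map_add' := fun _ _ => rfl
      map_smul' := fun _ _ => rfl }

/-- The position of a particle as a linear map on phase space. -/
def positionCLM (l : Λ) : PhaseSpace Λ n →L[ℝ] EuclideanSpace ℝ (Fin n) :=
  LinearMap.toContinuousLinearMap
    { toFun := fun w => position w l
      map_add' := fun _ _ => rfl
      map_smul' := fun _ _ => rfl }

/-- The relative position of two particles as a linear map on phase space. -/
def relativePositionCLM (k l : Λ) : PhaseSpace Λ n →L[ℝ] EuclideanSpace ℝ (Fin n) :=
  positionCLM k - positionCLM l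

/-- The symplectic matrix that turns gradients into Hamiltonian vector fields. -/
def symplecticCLM : PhaseSpace Λ n →L[ℝ] PhaseSpace Λ n :=
  LinearMap.toContinuousLinearMap
    { toFun := fun z => WithLp.toLp 2 (Sum.elim (fun a => -z (Sum.inr a)) fun a => z (Sum.inl a))
      map_add' := fun x y => by
        ext (a | a)
        · simp; ring
        · simp
      map_smul' := fun c x => by
        ext (a | a) <;> simp }

theorem hamiltonianVectorField_eq {H : PhaseSpace Λ n → ℝ} {w g : PhaseSpace Λ n}
    (h : HasGradientAt H g w) : hamiltonianVectorField H w = symplecticCLM g := by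
  rw [hamiltonianVectorField, h.gradient]
  rfl

/-- The generator of the flow of the free Hamiltonian. -/
def freeGenerator (m ν : Γ → ℝ) : PhaseSpace Λ n →L[ℝ] PhaseSpace Λ n :=
  symplecticCLM.comp (∑ l : Λ,
    ((m l)⁻¹ • (ContinuousLinearMap.adjoint (momentumCLM l)).comp (momentumCLM l) +
      ν l • (ContinuousLinearMap.adjoint (positionCLM l)).comp (positionCLM l)))

/-- The contribution of the pair potential of two particles to the Hamiltonian vector field, as a
function of their relative position. -/
def pairForce (V : Γ → Γ → EuclideanSpace ℝ (Fin n) → ℝ) (a : Λ × Λ)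
    (y : EuclideanSpace ℝ (Fin n)) : PhaseSpace Λ n :=
  symplecticCLM (ContinuousLinearMap.adjoint (relativePositionCLM a.1 a.2)
    (gradient (V a.1 a.2) y))

theorem hamiltonianVectorField_localHamiltonian (m ν : Γ → ℝ)
    {V : Γ → Γ → EuclideanSpace ℝ (Fin n) → ℝ} (hV : ∀ k l, Differentiable ℝ (V k l))
    (w : PhaseSpace Λ n) :
    hamiltonianVectorField (localHamiltonian Λ n m ν V) w =
      freeGenerator m ν w + ∑ a : Λ × Λ, pairForce V a ((relativePositionCLM a.1 a.2) w) := by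
  have h1 : ∀ l : Λ, HasGradientAt
      (fun w : PhaseSpace Λ n => ‖momentum w l‖ ^ 2 / (2 * m l) + ν l * ‖position w l‖ ^ 2 / 2)
      ((m l)⁻¹ • ContinuousLinearMap.adjoint (momentumCLM l) (momentumCLM l w) +
        ν l • ContinuousLinearMap.adjoint (positionCLM l) (positionCLM l w)) w := fun l => by
    have e1 := (hasGradientAt_const_mul_norm_sq (1 / (2 * m l)) (momentumCLM l w)).comp_clm
    have e2 := (hasGradientAt_const_mul_norm_sq (ν l / 2) (positionCLM l w)).comp_clm
    convert! e1.fun_add' e2 using 1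
    · ext z
      change _ = 1 / (2 * m l) * ‖momentum z l‖ ^ 2 + ν l / 2 * ‖position z l‖ ^ 2
      ring
    · rw [map_smul, map_smul]
      congr 2
      · rw [one_div, mul_inv, mul_inv_cancel_left₀ two_ne_zero]
      · ring
  have h2 : ∀ k l : Λ, HasGradientAt
      (fun w : PhaseSpace Λ n => V k l (position w k - position w l))
      (ContinuousLinearMap.adjoint (relativePositionCLM k l)
        (gradient (V k l) ((relativePositionCLM k l) w))) w := fun k l =>
    ((hV k l _).hasGradientAt).comp_clm (relativePositionCLM k l)
  have h3 := (hasGradientAt_finset_sum Finset.univ h1).fun_add'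
    (hasGradientAt_finset_sum Finset.univ fun k => hasGradientAt_finset_sum Finset.univ (h2 k))
  refine (hamiltonianVectorField_eq h3).trans ?_
  simp only [freeGenerator, pairForce, map_add, ContinuousLinearMap.comp_apply,
    sum_apply, map_sum, Fintype.sum_prod_type, add_apply,
    smul_apply]

end

end

theorem mainTheorem7 {Γ : Type*} (n : ℕ) (m ν : Γ → ℝ)
    (hm : ∀ l, 0 < m l) (hν : ∀ l, 0 < ν l)
    (V : Γ → Γ → EuclideanSpace ℝ (Fin n) → ℝ)
    (hsymm : ∀ k l x, V k l x = V l k (-x))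
    (hC1 : ∀ k l, ContDiff ℝ 1 (V k l))
    (hC0 : ∀ k l, Filter.Tendsto (V k l)
      (Filter.cocompact (EuclideanSpace ℝ (Fin n))) (nhds 0))
    (hLip : ∀ k l, ∃ K : NNReal, LipschitzWith K (gradient (V k l)))
    (Λ : Finset Γ) :
    ∃ Φ : ℝ → (PhaseSpace Λ n ≃ₜ PhaseSpace Λ n),
      IsHamiltonianFlow (localHamiltonian Λ n m ν V) (fun t w => Φ t w) ∧
      ∀ t : ℝ,
        (fun f : PhaseSpace Λ n →ᵇ ℂ =>
            f.compContinuous (Φ t : C(PhaseSpace Λ n, PhaseSpace Λ n))) ''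
            (resolventAlgebra (PhaseSpace Λ n) : Set (PhaseSpace Λ n →ᵇ ℂ)) =
          (resolventAlgebra (PhaseSpace Λ n) : Set (PhaseSpace Λ n →ᵇ ℂ)) := by
  have hd : ∀ k l, Differentiable ℝ (V k l) := fun k l => (hC1 k l).differentiable one_ne_zero
  have hvf := hamiltonianVectorField_localHamiltonian (Λ := Λ) m ν hd
  obtain ⟨Φ, hΦ0, hΦ, hu, hinv, hmem⟩ := exists_flow_preserving_resolventAlgebra
    (freeGenerator (Λ := Λ) (n := n) m ν)
    (fun a : Λ × Λ => relativePositionCLM a.1 a.2) (G := pairForce V)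
    (fun a => by
      obtain ⟨K, hK⟩ := hLip a.1 a.2
      exact ⟨_, (symplecticCLM.comp (ContinuousLinearMap.adjoint
        (relativePositionCLM a.1 a.2))).lipschitz.comp hK⟩)
    (fun a => by
      obtain ⟨K, hK⟩ := hLip a.1 a.2
      have h := ((symplecticCLM.comp (ContinuousLinearMap.adjoint
        (relativePositionCLM a.1 a.2) : _ →L[ℝ] PhaseSpace Λ n)).continuous.tendsto 0).comp
        (tendsto_gradient_cocompact (hd _ _) (hC0 a.1 a.2) hK)
      rw [map_zero] at h
      exact h)
  refine ⟨Φ, ⟨hΦ0, fun w t => ?_, fun γ hγ t => ?_⟩, fun t => ?_⟩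
  · rw [hvf]
    exact hΦ w t
  · refine hu γ (fun t => ?_) t
    rw [← hvf]
    exact hγ t
  · refine Set.Subset.antisymm ?_ fun f hf => ?_
    · rintro _ ⟨f, hf, rfl⟩
      exact hmem t f hf
    -- Surjectivity: `f` is the pullback under `Φ t` of `f ∘ Φ (-t)`.
    · refine ⟨_, hmem (-t) f hf, ?_⟩
      ext w
      exact congrArg f (hinv t w)
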